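/- Let $(\Omega,\Sigma)$ be a measurable space and let $\Delta(\Omega)$ be the set of all finitely additive probability measures on $\Sigma$, with the weak* topology, i.e. the topology of eventwise convergence ($p_i\to p$ iff $p_i(A)\to p(A)$ for every $A\in\Sigma$). A capacity is a function $\nu:\Sigma\to[0,1]$ with $\nu(\emptyset)=0$, $\nu(\Omega)=1$ and $\nu(A)\le\nu(B)$ whenever $A\subseteq B$; it is convex if $\nu(A\cup B)+\nu(A\cap B)\ge\nu(A)+\nu(B)$ for all $A,B\in\Sigma$. Its core is $C_\nu=\{p\in\Delta(\Omega): p(A)\ge\nu(A)\text{ for all }A\in\Sigma\}$. For $C\subseteq\Delta(\Omega)$ and $A\in\Sigma$ let $C^*(A)=\{p\in C: p(A)\ge q(A)\text{ for all }q\in C\}$. Call $C$ comonotonic if for every $n\ge 1$ and all events $A_1\subseteq A_2\subseteq\cdots\subseteq A_n$ in $\Sigma$ one has $C^*(A_1)\cap C^*(A_2)\cap\cdots\cap C^*(A_n)\neq\emptyset$. Proposition. Let $C\subseteq\Delta(\Omega)$ be convex and compact. Then there is a convex capacity $\nu$ with $C=C_\nu$ if and only if $C$ is comonotonic. -/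

import Mathlib

namespace Ambiguity

/-- The events of a measurable space: the elements of its sigma-algebra. -/
abbrev Event (Ω : Type*) [MeasurableSpace Ω] : Type _ := {A : Set Ω // MeasurableSet A}

/-- The sure event. -/
def Event.sure (Ω : Type*) [MeasurableSpace Ω] : Event Ω := ⟨Set.univ, MeasurableSet.univ⟩

/-- Finitely additive probability measures on the events of `Ω`. -/
structure IsFinAddProb {Ω : Type*} [MeasurableSpace Ω] (p : Event Ω → ℝ) : Prop where
  nonneg : ∀ A, 0 ≤ p A
  sure : p (Event.sure Ω) = 1
  union : ∀ A B : Event Ω, Disjoint (A : Set Ω) (B : Set Ω) → p (A ∪ B) = p A + p B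

/-- The set of all finitely additive probability measures, as a subset of the space of
real-valued set functions on the sigma-algebra. The latter carries the topology of eventwise
convergence (the product topology), which on this subset is the weak-star topology. -/
def finAddProbs (Ω : Type*) [MeasurableSpace Ω] : Set (Event Ω → ℝ) := {p | IsFinAddProb p}

/-- Capacities (normalized monotone set functions on the sigma-algebra, hence with values
in `[0, 1]`). -/
structure IsCapacity {Ω : Type*} [MeasurableSpace Ω] (ν : Event Ω → ℝ) : Prop where
  empty : ν ∅ = 0
  sure : ν (Event.sure Ω) = 1
  mono : ∀ A B : Event Ω, (A : Set Ω) ⊆ B → ν A ≤ ν B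

/-- Convexity (supermodularity) of a set function. -/
def IsConvexSetFun {Ω : Type*} [MeasurableSpace Ω] (ν : Event Ω → ℝ) : Prop :=
  ∀ A B : Event Ω, ν A + ν B ≤ ν (A ∪ B) + ν (A ∩ B)

/-- The core of a set function: the finitely additive probabilities that dominate it. -/
def core {Ω : Type*} [MeasurableSpace Ω] (ν : Event Ω → ℝ) : Set (Event Ω → ℝ) :=
  {p | p ∈ finAddProbs Ω ∧ ∀ A, ν A ≤ p A}

/-- The elements of `C` that maximize the probability of the event `A` over `C`. -/
def maximizers {Ω : Type*} [MeasurableSpace Ω] (C : Set (Event Ω → ℝ)) (A : Event Ω) :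
    Set (Event Ω → ℝ) :=
  {p | p ∈ C ∧ ∀ q ∈ C, q A ≤ p A}

/-- A finite sequence of events is comonotonic for `C` if a single element of `C` maximizes the
probability of all of them. -/
def ComonotonicEvents {Ω : Type*} [MeasurableSpace Ω] (C : Set (Event Ω → ℝ)) {n : ℕ}
    (A : Fin n → Event Ω) : Prop :=
  (⋂ i, maximizers C (A i)).Nonempty

/-- `C` is comonotonic if every nonempty finite nested sequence `A₁ ⊆ ⋯ ⊆ Aₙ` of events is
comonotonic for `C`. -/
def IsComonotonic {Ω : Type*} [MeasurableSpace Ω] (C : Set (Event Ω → ℝ)) : Prop :=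
  ∀ (n : ℕ) (A : Fin (n + 1) → Event Ω),
    (∀ i j, i ≤ j → (A i : Set Ω) ⊆ A j) → ComonotonicEvents C A

end Ambiguity

namespace Ambiguity

open Set

variable {Ω : Type*} [MeasurableSpace Ω]

/-! ### Finitely additive probabilities -/

/-! If `C` is comonotonic, let ν be its lower envelope; a common minimizer on `A ∩ B ⊆ A ∪ B` gives
convexity. Were some `q` in the core of ν outside `C`, a simple function `g` would have a smaller
integral under `q` than under all of `C`. But the upper level sets of `g` are nested, so one `p ∈ C`
minimizes them all; `q` then dominates `p` stochastically, a contradiction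
(`core_subset_of_isComonotonic`). Conversely, `splitting` enlarges a convex capacity to one additive
across `E`, keeping its values on events comparable with `E`. A maximal convex capacity is thus a
probability (`core_nonempty`). Splitting first over the complements of a chain yields a core element
that equals ν on them. -/

theorem IsFinAddProb.empty {p : Event Ω → ℝ} (hp : IsFinAddProb p) : p ∅ = 0 := by
  have h := hp.union ∅ ∅ (by simp)
  rw [show (∅ : Event Ω) ∪ ∅ = ∅ from Subtype.ext (by simp)] at h
  linarith

theorem IsFinAddProb.compl {p : Event Ω → ℝ} (hp : IsFinAddProb p) (A : Event Ω) :
    p Aᶜ = 1 - p A := by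
  have h := hp.union A Aᶜ (by simpa using disjoint_compl_right)
  rw [show A ∪ Aᶜ = Event.sure Ω from Subtype.ext (by simp [Event.sure]), hp.sure] at h
  linarith

theorem IsFinAddProb.inter_add_diff {p : Event Ω → ℝ} (hp : IsFinAddProb p) (A E : Event Ω) :
    p (A ∩ E) + p (A \ E) = p A := by
  rw [← hp.union (A ∩ E) (A \ E) (by simpa using disjoint_sdiff_inter.symm)]
  exact congrArg p (Subtype.ext (by simp))

theorem IsFinAddProb.mono {p : Event Ω → ℝ} (hp : IsFinAddProb p) {A B : Event Ω}
    (h : (A : Set Ω) ⊆ B) : p A ≤ p B := by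
  have h1 := hp.inter_add_diff B A
  rw [show B ∩ A = A from Subtype.ext (by simpa using h)] at h1
  linarith [hp.nonneg (B \ A)]

theorem IsFinAddProb.union_add_inter {p : Event Ω → ℝ} (hp : IsFinAddProb p) (A B : Event Ω) :
    p (A ∪ B) + p (A ∩ B) = p A + p B := by
  have h1 := hp.inter_add_diff (A ∪ B) B
  have h2 := hp.inter_add_diff A B
  rw [show (A ∪ B) ∩ B = B from Subtype.ext (by simp),
    show (A ∪ B) \ B = A \ B from Subtype.ext (by simp)] at h1
  linarith

/-- The event that a measurable map into a finite discrete space takes a value in `T`. -/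
def preimageEvent {K : Type*} [MeasurableSpace K] [MeasurableSingletonClass K] {X : Ω → K}
    (hX : Measurable X) (T : Finset K) : Event Ω :=
  ⟨X ⁻¹' T, hX T.measurableSet⟩

theorem IsFinAddProb.preimageEvent_eq_sum {p : Event Ω → ℝ} (hp : IsFinAddProb p) {K : Type*}
    [MeasurableSpace K] [MeasurableSingletonClass K] {X : Ω → K} (hX : Measurable X)
    (T : Finset K) : p (preimageEvent hX T) = ∑ k ∈ T, p (preimageEvent hX {k}) := by
  classical
  induction T using Finset.induction_on with
  | empty =>
    rw [show preimageEvent hX ∅ = ∅ from Subtype.ext (by simp [preimageEvent]), hp.empty]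
    simp
  | insert a T ha ih =>
    rw [Finset.sum_insert ha, ← ih, ← hp.union]
    · exact congrArg p (Subtype.ext (by ext; simp [preimageEvent]))
    · simp only [preimageEvent, Finset.coe_singleton]
      exact (disjoint_singleton_left.2 (by simpa using ha)).preimage X

/-- First-order stochastic dominance: nonnegative upper tails give a nonnegative integral. -/
theorem sum_sub_mul_nonneg_of_tails_nonneg {K : Type*} (g w : K → ℝ) (s : Finset K) :
    ∀ c : ℝ, (∀ k ∈ s, c ≤ g k) →
      (∀ b ∈ s, c < g b → 0 ≤ ∑ k ∈ s with g b ≤ g k, w k) →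
      0 ≤ ∑ k ∈ s, (g k - c) * w k := by
  classical
  -- Abel summation: peeling off a minimizer `a` of `g` raises the baseline from `c` to `g a`, and
  -- no tail strictly above `g a` contains `a`.
  induction s using Finset.induction_on_min_value g with
  | empty => simp
  | insert a s ha hmin ih =>
    intro c hc ht
    have h1 : 0 ≤ ∑ k ∈ s, (g k - g a) * w k := by
      refine ih (g a) hmin fun b hb hab => ?_
      have h := ht b (Finset.mem_insert_of_mem hb)
        ((hc a (Finset.mem_insert_self a s)).trans_lt hab)
      rwa [Finset.filter_insert, if_neg hab.not_ge] at h
    have h2 : 0 ≤ (g a - c) * ∑ k ∈ insert a s, w k := by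
      rcases (hc a (Finset.mem_insert_self a s)).eq_or_lt with h | h
      · simp [h]
      · refine mul_nonneg (sub_nonneg.2 h.le) ?_
        have h3 := ht a (Finset.mem_insert_self a s) h
        rwa [Finset.filter_true_of_mem] at h3
        intro k hk
        rcases Finset.mem_insert.1 hk with rfl | hk
        exacts [le_rfl, hmin k hk]
    have h3 : ∑ k ∈ insert a s, (g k - c) * w k =
        ∑ k ∈ s, (g k - g a) * w k + (g a - c) * ∑ k ∈ insert a s, w k := by
      rw [Finset.sum_insert ha, Finset.sum_insert ha, mul_add, Finset.mul_sum, add_left_comm,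
        ← Finset.sum_add_distrib]
      exact congrArg _ (Finset.sum_congr rfl fun k _ => by ring)
    rw [h3]
    exact add_nonneg h1 h2

theorem sum_mul_nonneg_of_tails_nonneg {K : Type*} [Fintype K] (g w : K → ℝ)
    (hw : ∑ k, w k = 0) (ht : ∀ b, 0 ≤ ∑ k with g b ≤ g k, w k) : 0 ≤ ∑ k, g k * w k := by
  obtain ⟨c, hc⟩ := (finite_range g).bddBelow
  have h := sum_sub_mul_nonneg_of_tails_nonneg g w Finset.univ c
    (fun k _ => hc (mem_range_self k)) fun b _ _ => ht b
  simpa [sub_mul, Finset.sum_sub_distrib, ← Finset.mul_sum, hw] using h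

/-- The atoms of the algebra generated by a finite family of events determine the linear
combinations of their probabilities. -/
theorem IsFinAddProb.sum_mul_eq_sum_atoms {p : Event Ω → ℝ} (hp : IsFinAddProb p) {ι : Type*}
    [Fintype ι] [Fintype (ι → Prop)] (A : ι → Event Ω) (a : ι → ℝ)
    (hX : Measurable fun ω i => ω ∈ (A i : Set Ω)) :
    ∑ i, a i * p (A i) =
      ∑ k : ι → Prop, (∑ i, a i * (open Classical in if k i then 1 else 0)) *
        p (preimageEvent hX {k}) := by
  classical
  have h : ∀ i, p (A i) = ∑ k : ι → Prop with k i, p (preimageEvent hX {k}) := fun i => by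
    rw [← hp.preimageEvent_eq_sum]
    exact congrArg p (Subtype.ext (by ext; simp [preimageEvent]))
  simp_rw [Finset.sum_mul, h, Finset.mul_sum]
  rw [Finset.sum_comm]
  simp [Finset.sum_filter]

/-! ### Comonotonic sets are cores -/

theorem IsComonotonic.exists_minimizer {C : Set (Event Ω → ℝ)} (hC : C ⊆ finAddProbs Ω)
    (hco : IsComonotonic C) (n : ℕ) (A : Fin (n + 1) → Event Ω)
    (hA : ∀ i j, i ≤ j → (A j : Set Ω) ⊆ A i) :
    ∃ p ∈ C, ∀ i, ∀ q ∈ C, p (A i) ≤ q (A i) := by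
  obtain ⟨p, hp⟩ := hco n (fun i => (A i)ᶜ) fun i j hij => by
    simpa using hA i j hij
  rw [mem_iInter] at hp
  refine ⟨p, (hp 0).1, fun i q hq => ?_⟩
  have h := (hp i).2 q hq
  rw [(hC hq).compl, (hC (hp 0).1).compl] at h
  linarith

theorem core_subset_of_isComonotonic {C : Set (Event Ω → ℝ)} (hC : C ⊆ finAddProbs Ω)
    (hconv : Convex ℝ C) (hcomp : IsCompact C) (hco : IsComonotonic C) {ν : Event Ω → ℝ}
    (hν : ∀ A, ∃ p ∈ C, p A = ν A) : core ν ⊆ C := by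
  classical
  rintro q ⟨hq, hνq⟩
  by_contra hqC
  -- A basic neighbourhood of `q` missing `C` involves finitely many events, so separation takes
  -- place in `I → ℝ`.
  obtain ⟨I, u, hu, hIu⟩ := isOpen_pi_iff.1 hcomp.isClosed.isOpen_compl q hqC
  let R : (Event Ω → ℝ) →L[ℝ] (I → ℝ) := ContinuousLinearMap.pi fun i => .proj i.1
  have hRq : R q ∉ R '' C := by
    rintro ⟨p, hp, hpq⟩
    refine hIu (fun i hi => ?_) hp
    have h : p i = q i := congrFun hpq ⟨i, hi⟩
    rw [h]
    exact (hu i hi).2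
  obtain ⟨f, v, hv, hf⟩ := geometric_hahn_banach_point_closed
    (hconv.linear_image R.toLinearMap) (hcomp.image R.continuous).isClosed hRq
  have hfR : ∀ p : Event Ω → ℝ, f (R p) = ∑ i : I, f (Pi.single i 1) * p i := fun p => by
    have h := LinearMap.pi_apply_eq_sum_univ (f : (I → ℝ) →ₗ[ℝ] ℝ) (R p)
    simp only [ContinuousLinearMap.coe_coe, smul_eq_mul] at h
    rw [h]
    refine Finset.sum_congr rfl fun i _ => ?_
    rw [mul_comm]
    congr 2
    ext j
    simp [Pi.single_apply, eq_comm]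
  have hX : Measurable fun ω (i : I) => ω ∈ (i.1 : Set Ω) :=
    measurable_pi_lambda _ fun i => measurableSet_setOfPred.1 i.1.2
  -- The separating functional is integration of `g`, a function on the atoms.
  set g : (I → Prop) → ℝ := fun k => ∑ i, f (Pi.single i 1) * if k i then 1 else 0 with hg
  let T : Finset ℝ := Finset.univ.image g
  obtain ⟨n, hn⟩ : ∃ n, T.card = n + 1 :=
    Nat.exists_eq_succ_of_ne_zero (Finset.card_ne_zero.2 (Finset.univ_nonempty.image g))
  obtain ⟨p, hpC, hp⟩ := hco.exists_minimizer hC n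
    (fun j => preimageEvent hX {k | T.orderEmbOfFin hn j ≤ g k}) fun i j hij ω hω => by
      simp only [preimageEvent, Finset.coe_filter, Finset.mem_univ, true_and, mem_preimage,
        mem_ofPred_eq] at hω ⊢
      exact ((T.orderEmbOfFin hn).monotone hij).trans hω
  have hpP : IsFinAddProb p := hC hpC
  have key : 0 ≤ ∑ k, g k * (q (preimageEvent hX {k}) - p (preimageEvent hX {k})) := by
    refine sum_mul_nonneg_of_tails_nonneg g _ ?_ fun b => ?_
    · rw [Finset.sum_sub_distrib, ← hpP.preimageEvent_eq_sum,
        ← IsFinAddProb.preimageEvent_eq_sum hq,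
        show preimageEvent hX Finset.univ = Event.sure Ω from
          Subtype.ext (by simp [preimageEvent, Event.sure]), hpP.sure, hq.sure, sub_self]
    · rw [Finset.sum_sub_distrib, ← hpP.preimageEvent_eq_sum,
        ← IsFinAddProb.preimageEvent_eq_sum hq]
      obtain ⟨j, hj⟩ : g b ∈ range (T.orderEmbOfFin hn) := by
        rw [Finset.range_orderEmbOfFin]
        simp [T]
      rw [← hj]
      obtain ⟨r, hr, hrν⟩ := hν (preimageEvent hX {k | T.orderEmbOfFin hn j ≤ g k})
      linarith [hp j r hr, hνq (preimageEvent hX {k | T.orderEmbOfFin hn j ≤ g k})]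
  have h := hf (R p) ⟨p, hpC, rfl⟩
  rw [hfR, hpP.sum_mul_eq_sum_atoms (fun i : I => i.1) _ hX] at h
  rw [hfR, IsFinAddProb.sum_mul_eq_sum_atoms hq (fun i : I => i.1) _ hX] at hv
  simp only [mul_sub, Finset.sum_sub_distrib] at key
  simp only [hg] at key
  linarith

theorem exists_convex_capacity_of_isComonotonic {C : Set (Event Ω → ℝ)}
    (hC : C ⊆ finAddProbs Ω) (hconv : Convex ℝ C) (hcomp : IsCompact C)
    (hco : IsComonotonic C) : ∃ ν, IsCapacity ν ∧ IsConvexSetFun ν ∧ C = core ν := by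
  have hmin : ∀ A : Event Ω, ∃ p ∈ C, ∀ q ∈ C, p A ≤ q A := fun A =>
    (hco.exists_minimizer hC 0 (fun _ => A) fun _ _ _ => Subset.rfl).imp
      fun p hp => ⟨hp.1, hp.2 0⟩
  choose m hmC hm using hmin
  have hP : ∀ A, IsFinAddProb (m A) := fun A => hC (hmC A)
  refine ⟨fun A => m A A, ⟨(hP _).empty, (hP _).sure, fun A B hAB => ?_⟩, fun A B => ?_, ?_⟩
  · exact (hm A _ (hmC B)).trans ((hP B).mono hAB)
  · obtain ⟨p, hpC, hp⟩ := hco.exists_minimizer hC 1 ![A ∪ B, A ∩ B] (by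
      intro i j hij
      fin_cases i <;> fin_cases j <;> simp at hij ⊢
      exact inter_subset_left.trans subset_union_left)
    have h0 := hp 0 _ (hmC (A ∪ B))
    have h1 := hp 1 _ (hmC (A ∩ B))
    simp only [Matrix.cons_val_zero, Matrix.cons_val_one] at h0 h1
    have h2 : IsFinAddProb p := hC hpC
    linarith [hm A p hpC, hm B p hpC, h2.union_add_inter A B]
  · exact Subset.antisymm (fun p hp => ⟨hC hp, fun A => hm A p hp⟩)
      (core_subset_of_isComonotonic hC hconv hcomp hco fun A => ⟨m A, hmC A, rfl⟩)

/-! ### Cores of convex capacities are comonotonic -/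

/-- `ν` splits over `E` if it is additive with respect to the partition `{E, Eᶜ}`. -/
def SplitsOver (ν : Event Ω → ℝ) (E : Event Ω) : Prop :=
  ∀ A, ν (A ∩ E) + ν (A \ E) = ν A

/-- The modification of `ν` which splits over `E`. -/
def splitting (ν : Event Ω → ℝ) (E : Event Ω) : Event Ω → ℝ :=
  fun A => ν (A ∪ E) + ν (A ∩ E) - ν E

theorem le_splitting {ν : Event Ω → ℝ} (hν : IsConvexSetFun ν) (E A : Event Ω) :
    ν A ≤ splitting ν E A := by
  have := hν A E
  simp only [splitting]
  linarith

theorem splitting_of_subset (ν : Event Ω → ℝ) {E A : Event Ω} (h : (A : Set Ω) ⊆ E) :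
    splitting ν E A = ν A := by
  rw [splitting, show A ∪ E = E from Subtype.ext (by simpa using h),
    show A ∩ E = A from Subtype.ext (by simpa using h)]
  ring

theorem splitting_of_superset (ν : Event Ω → ℝ) {E A : Event Ω} (h : (E : Set Ω) ⊆ A) :
    splitting ν E A = ν A := by
  rw [splitting, show A ∪ E = A from Subtype.ext (by simpa using h),
    show A ∩ E = E from Subtype.ext (by simpa using h)]
  ring

theorem isCapacity_splitting {ν : Event Ω → ℝ} (hν : IsCapacity ν) (E : Event Ω) :
    IsCapacity (splitting ν E) where
  empty := by rw [splitting_of_subset ν (by simp), hν.empty]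
  sure := by rw [splitting_of_superset ν (by simp [Event.sure]), hν.sure]
  mono A B h := by
    have h1 := hν.mono (A ∪ E) (B ∪ E) (by simpa using union_subset_union_left _ h)
    have h2 := hν.mono (A ∩ E) (B ∩ E) (by simpa using inter_subset_inter_left _ h)
    simp only [splitting]
    linarith

theorem isConvexSetFun_splitting {ν : Event Ω → ℝ} (hν : IsConvexSetFun ν) (E : Event Ω) :
    IsConvexSetFun (splitting ν E) := fun A B => by
  have h1 := hν (A ∪ E) (B ∪ E)
  have h2 := hν (A ∩ E) (B ∩ E)
  rw [show (A ∪ E) ∪ (B ∪ E) = (A ∪ B) ∪ E from Subtype.ext (by ext; simp; tauto),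
    show (A ∪ E) ∩ (B ∪ E) = (A ∩ B) ∪ E from Subtype.ext (by ext; simp; tauto)] at h1
  rw [show (A ∩ E) ∪ (B ∩ E) = (A ∪ B) ∩ E from Subtype.ext (by ext; simp; tauto),
    show (A ∩ E) ∩ (B ∩ E) = (A ∩ B) ∩ E from Subtype.ext (by ext; simp; tauto)] at h2
  simp only [splitting]
  linarith

theorem splitsOver_splitting {ν : Event Ω → ℝ} (hν : ν ∅ = 0) (E : Event Ω) :
    SplitsOver (splitting ν E) E := fun A => by
  rw [splitting_of_subset ν (by simp)]
  simp only [splitting]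
  rw [show (A \ E) ∪ E = A ∪ E from Subtype.ext (by simp),
    show (A \ E) ∩ E = ∅ from Subtype.ext (by simp), hν]
  ring

/-- Later splittings do not undo earlier ones. -/
theorem SplitsOver.splitting {ν : Event Ω → ℝ} {F : Event Ω} (hF : SplitsOver ν F)
    (E : Event Ω) : SplitsOver (splitting ν E) F := fun A => by
  simp only [Ambiguity.splitting]
  have h1 := hF (A ∩ E)
  have h2 := hF (A ∪ E)
  have h3 := hF ((A ∩ F) ∪ E)
  have h4 := hF ((A \ F) ∪ E)
  have h5 := hF E
  rw [show (A ∩ E) ∩ F = (A ∩ F) ∩ E from Subtype.ext (by ext; simp; tauto),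
    show (A ∩ E) \ F = (A \ F) ∩ E from Subtype.ext (by ext; simp; tauto)] at h1
  rw [show ((A ∩ F) ∪ E) ∩ F = (A ∪ E) ∩ F from Subtype.ext (by ext; simp; tauto),
    show ((A ∩ F) ∪ E) \ F = E \ F from Subtype.ext (by ext; simp; tauto)] at h3
  rw [show ((A \ F) ∪ E) ∩ F = E ∩ F from Subtype.ext (by ext; simp; tauto),
    show ((A \ F) ∪ E) \ F = (A ∪ E) \ F from Subtype.ext (by ext; simp; tauto)] at h4
  linarith

theorem isFinAddProb_of_splitsOver {μ : Event Ω → ℝ} (hμ : IsCapacity μ)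
    (h : ∀ E, SplitsOver μ E) : IsFinAddProb μ where
  nonneg A := hμ.empty ▸ hμ.mono ∅ A (by simp)
  sure := hμ.sure
  union A B hAB := by
    rw [← h A (A ∪ B), show (A ∪ B) ∩ A = A from Subtype.ext (by simp),
      show (A ∪ B) \ A = B from Subtype.ext (by simpa using hAB.symm.sdiff_eq_left)]

/-- A finite nested family of events can be split over without changing the values on it. -/
theorem exists_splitsOver_of_nested {ν : Event Ω → ℝ} (hν : IsCapacity ν)
    (hconv : IsConvexSetFun ν) {ι : Type*} (B : ι → Event Ω)
    (hB : ∀ i j, (B i : Set Ω) ⊆ B j ∨ (B j : Set Ω) ⊆ B i) (s : Finset ι) :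
    ∃ μ, IsCapacity μ ∧ IsConvexSetFun μ ∧ ν ≤ μ ∧ (∀ i, μ (B i) = ν (B i)) ∧
      ∀ i ∈ s, SplitsOver μ (B i) := by
  classical
  induction s using Finset.induction_on with
  | empty => exact ⟨ν, hν, hconv, le_rfl, fun _ => rfl, by simp⟩
  | insert a s _ ih =>
    obtain ⟨μ, h1, h2, h3, h4, h5⟩ := ih
    refine ⟨splitting μ (B a), isCapacity_splitting h1 _, isConvexSetFun_splitting h2 _,
      h3.trans fun A => le_splitting h2 _ A, fun i => ?_, fun i hi => ?_⟩
    · rw [← h4 i]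
      rcases hB i a with h | h
      exacts [splitting_of_subset μ h, splitting_of_superset μ h]
    · rcases Finset.mem_insert.1 hi with rfl | hi
      exacts [splitsOver_splitting h1.empty _, (h5 i hi).splitting _]

theorem IsCapacity.le_one {ν : Event Ω → ℝ} (hν : IsCapacity ν) (A : Event Ω) : ν A ≤ 1 :=
  hν.sure ▸ hν.mono A _ (by simp [Event.sure])

/-- Every convex capacity is dominated by a finitely additive probability. -/
theorem core_nonempty {ν : Event Ω → ℝ} (hν : IsCapacity ν) (hconv : IsConvexSetFun ν) :
    (core ν).Nonempty := by
  obtain ⟨μ, hνμ, hmax⟩ := zorn_le_nonempty₀ {μ : Event Ω → ℝ | IsCapacity μ ∧ IsConvexSetFun μ}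
    (fun c hc hchain y hy => by
      have hbdd : ∀ A, BddAbove (range fun μ : c => μ.1 A) := fun A =>
        ⟨1, by rintro _ ⟨μ, rfl⟩; exact (hc μ.2).1.le_one A⟩
      have hle : ∀ (μ : c) A, μ.1 A ≤ ⨆ μ : c, μ.1 A := fun μ A => le_ciSup (hbdd A) μ
      have : Nonempty c := ⟨⟨y, hy⟩⟩
      refine ⟨fun A => ⨆ μ : c, μ.1 A, ⟨⟨?_, ?_, fun A B hAB => ?_⟩, fun A B => ?_⟩,
        fun μ hμ A => hle ⟨μ, hμ⟩ A⟩
      · simp [(hc (Subtype.prop _)).1.empty]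
      · simp [(hc (Subtype.prop _)).1.sure]
      · exact ciSup_le fun μ => ((hc μ.2).1.mono A B hAB).trans (hle μ B)
      · refine ciSup_add_ciSup_le fun μ₁ μ₂ => ?_
        -- The larger of the two capacities bounds both terms, and its own convexity applies.
        rcases hchain.total μ₁.2 μ₂.2 with h | h
        · linarith [h A, (hc μ₂.2).2 A B, hle μ₂ (A ∪ B), hle μ₂ (A ∩ B)]
        · linarith [h B, (hc μ₁.2).2 A B, hle μ₁ (A ∪ B), hle μ₁ (A ∩ B)])
    ν ⟨hν, hconv⟩
  obtain ⟨hμ, hμc⟩ := hmax.prop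
  refine ⟨μ, isFinAddProb_of_splitsOver hμ fun E => ?_, hνμ⟩
  have h := hmax.eq_of_le ⟨isCapacity_splitting hμ E, isConvexSetFun_splitting hμc E⟩
    fun A => le_splitting hμc E A
  rw [h]
  exact splitsOver_splitting hμ.empty E

/-- Domination on `E` and on `Eᶜ` is tight, since both pairs of values sum to 1. -/
theorem eq_of_mem_core_of_splitsOver {μ p : Event Ω → ℝ} (hμ : IsCapacity μ) {E : Event Ω}
    (hE : SplitsOver μ E) (hp : p ∈ core μ) : p E = μ E := by
  have h1 := hE (Event.sure Ω)
  rw [show Event.sure Ω ∩ E = E from Subtype.ext (by simp [Event.sure]),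
    show Event.sure Ω \ E = Eᶜ from Subtype.ext (by simp [Event.sure, compl_eq_univ_sdiff]),
    hμ.sure] at h1
  have h2 := hp.2 Eᶜ
  rw [hp.1.compl] at h2
  linarith [hp.2 E]

theorem isComonotonic_core {ν : Event Ω → ℝ} (hν : IsCapacity ν) (hconv : IsConvexSetFun ν) :
    IsComonotonic (core ν) := by
  intro n A hA
  obtain ⟨μ, h1, h2, h3, h4, h5⟩ := exists_splitsOver_of_nested hν hconv (fun i => (A i)ᶜ)
    (fun i j => by simpa using (le_total j i).imp (hA j i) (hA i j)) Finset.univ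
  obtain ⟨p, hp⟩ := core_nonempty h1 h2
  refine ⟨p, mem_iInter.2 fun i => ⟨⟨hp.1, fun A => (h3 A).trans (hp.2 A)⟩, fun q hq => ?_⟩⟩
  have h6 := eq_of_mem_core_of_splitsOver h1 (h5 i (Finset.mem_univ i)) hp
  have h7 := hq.2 (A i)ᶜ
  rw [h4, hp.1.compl] at h6
  rw [hq.1.compl] at h7
  linarith

end Ambiguity

theorem mainTheorem3 {Ω : Type*} [MeasurableSpace Ω] (C : Set (Ambiguity.Event Ω → ℝ))
    (hC : C ⊆ Ambiguity.finAddProbs Ω) (hconv : Convex ℝ C) (hcomp : IsCompact C) :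
    (∃ ν : Ambiguity.Event Ω → ℝ, Ambiguity.IsCapacity ν ∧ Ambiguity.IsConvexSetFun ν ∧
      C = Ambiguity.core ν) ↔ Ambiguity.IsComonotonic C := by
  constructor
  · rintro ⟨ν, hν, hνc, rfl⟩
    exact Ambiguity.isComonotonic_core hν hνc
  · exact Ambiguity.exists_convex_capacity_of_isComonotonic hC hconv hcomp
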